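/- Let $(X,\mathcal{A},\mu)$ be a $\sigma$-finite measure space with $\mu(X)=\infty$ and $\mu$ continuous ($\mu\{x\}=0$ for all $x\in X$), and let $T:X\to X$ be an invertible, bi-measurable, $\mu$-preserving transformation. Let $X^*$ be the space of counting measures $\nu=\sum_{i\in I}\delta_{x_i}$ ($I$ countable, $x_i\in X$), with the $\sigma$-algebra $\mathcal{A}^*$ generated by the maps $N(A):\nu\mapsto\nu(A)$, $A\in\mathcal{A}$. For a $\sigma$-finite measure $\lambda$ on $X$ with $\lambda(X)=\infty$, let $\lambda^*$ be the probability measure on $X^*$ under which, for pairwise disjoint $A_1,\dots,A_k\in\mathcal{A}$ of finite measure, $N(A_1),\dots,N(A_k)$ are independent Poisson variables with parameters $\lambda(A_1),\dots,\lambda(A_k)$. Let $T_*\nu=\nu\circ T^{-1}$; the system $(X^*,\mathcal{A}^*,\lambda^*,T_*)$ is the Poisson suspension with intensity $\lambda$ (for $\lambda$ invariant under $T$). Let $\mathcal{A}^*\odot\mathcal{A}^*$ be the $\sigma$-algebra of the sets in $\mathcal{A}^*\otimes\mathcal{A}^*$ that are invariant under $(\nu_1,\nu_2)\mapsto(\nu_2,\nu_1)$,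 and let $T_*\odot T_*$ denote the system $(X^*\times X^*,\ \mathcal{A}^*\odot\mathcal{A}^*,\ \mu^*\otimes\mu^*,\ T_*\times T_*)$. A factor of a system $(Y,\mathcal{B},P,S)$ with $P$ a probability measure is a sub-$\sigma$-algebra $\mathcal{C}\subset\mathcal{B}$ with $S^{-1}\mathcal{C}=\mathcal{C}$; the system is prime if every factor is equal, modulo $P$-null sets, to $\mathcal{B}$ or to $\{Y,\emptyset\}$. Then $T_*\odot T_*$ is never prime. More precisely, the map $\Psi(\nu_1,\nu_2)=\nu_1+\nu_2$ is a factor map from $T_*\odot T_*$ onto the Poisson suspension $(X^*,\mathcal{A}^*,(2\mu)^*,T_*)$, that is, $\Psi$ is measurable for $\mathcal{A}^*\odot\mathcal{A}^*$, maps $\mu^*\otimes\mu^*$ to $(2\mu)^*$ and satisfies $\Psi\circ(T_*\times T_*)=T_*\circ\Psi$; and $\Psi^{-1}\mathcal{A}^*$ is a factor of $T_*\odot T_*$ which, modulo null sets, is neither $\mathcal{A}^*\odot\mathcal{A}^*$ nor trivial. -/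

import Mathlib

open MeasureTheory ProbabilityTheory
open scoped ENNReal NNReal

namespace PoissonSuspension

/-- `ν` is a counting measure: a sum of Dirac masses over a countable family of points of `X`
(repetitions and infinite families are allowed). -/
def IsCounting {X : Type*} [MeasurableSpace X] (ν : Measure X) : Prop :=
  ∃ (I : Type) (_ : Countable I) (x : I → X), ν = Measure.sum fun i => Measure.dirac (x i)

/-- The space `X*` of counting measures on `X`. As a subtype of `Measure X` it carries the
σ-algebra generated by the maps `ν ↦ ν A`, for `A` measurable. -/
abbrev Config (X : Type*) [MeasurableSpace X] : Type _ := {ν : Measure X // IsCounting ν}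

/-- The map `N(A)` on `X*`, which counts the points falling into `A`. -/
def count {X : Type*} [MeasurableSpace X] (A : Set X) (ν : Config X) : ℝ≥0∞ := ν.1 A

theorem measurable_count {X : Type*} [MeasurableSpace X] {A : Set X} (hA : MeasurableSet A) :
    Measurable (count A) :=
  (Measure.measurable_coe hA).comp measurable_subtype_coe

theorem isCounting_map {X Y : Type*} [MeasurableSpace X] [MeasurableSpace Y] {φ : X → Y}
    (hφ : Measurable φ) {ν : Measure X} (hν : IsCounting ν) : IsCounting (ν.map φ) := by
  obtain ⟨I, hI, x, rfl⟩ := hν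
  refine ⟨I, hI, fun i => φ (x i), ?_⟩
  rw [Measure.map_sum hφ.aemeasurable]
  simp [Measure.map_dirac' hφ]

theorem isCounting_sum {X : Type*} {J : Type} [MeasurableSpace X] [Countable J]
    {ν : J → Measure X} (hν : ∀ j, IsCounting (ν j)) : IsCounting (Measure.sum ν) := by
  choose I hI x hx using hν
  refine ⟨Σ j, I j, inferInstance, fun k => x k.1 k.2, ?_⟩
  ext s hs
  simp only [Measure.sum_apply _ hs, hx]
  exact (ENNReal.tsum_sigma fun i j => Measure.dirac (x i j) s).symm

theorem isCounting_add {X : Type*} [MeasurableSpace X] {ν₁ ν₂ : Measure X}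
    (h₁ : IsCounting ν₁) (h₂ : IsCounting ν₂) : IsCounting (ν₁ + ν₂) := by
  rw [← Measure.sum_cond]
  exact isCounting_sum fun b => by cases b <;> simpa

/-- `P` is the law of a Poisson measure with intensity `μ`: a probability measure on `X*` under
which `N(A)` has the Poisson distribution with parameter `μ A` whenever `μ A < ∞` (the Dirac mass
at `0` if `μ A = 0`), and `N(A₁), …, N(A_k)` are independent for pairwise disjoint measurable sets
of finite measure. -/
structure IsPoissonLaw {X : Type*} [MeasurableSpace X] (μ : Measure X)
    (P : Measure (Config X)) : Prop where
  isProbabilityMeasure : IsProbabilityMeasure P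
  law : ∀ A : Set X, MeasurableSet A → μ A < ∞ →
    P.map (count A) = (poissonMeasure (μ A).toNNReal).map (fun n : ℕ => (n : ℝ≥0∞))
  indep : ∀ (k : ℕ) (A : Fin k → Set X), (∀ i, MeasurableSet (A i)) →
    Pairwise (Function.onFun Disjoint A) → (∀ i, μ (A i) < ∞) →
    iIndepFun (fun i => count (A i)) P

/-- Auxiliary description of a Poisson law through its mean and its characteristic functions, used
only to prove that Poisson laws exist. -/
structure PoissonCF {X : Type*} [MeasurableSpace X] (μ : Measure X)
    (P : Measure (Config X)) : Prop where
  isProbabilityMeasure : IsProbabilityMeasure P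
  mean : ∀ A : Set X, MeasurableSet A → ∫⁻ ν, count A ν ∂P = μ A
  cf : ∀ (k : ℕ) (A : Fin k → Set X) (t : Fin k → ℝ), (∀ i, MeasurableSet (A i)) →
    Pairwise (Function.onFun Disjoint A) → (∀ i, μ (A i) < ∞) →
    charFun (P.map fun ν => ∑ i, t i * (count (A i) ν).toReal) 1 =
      Complex.exp (∑ i, (μ.real (A i) : ℂ) * (Complex.exp (t i * Complex.I) - 1))

theorem measurable_lin {X : Type*} [MeasurableSpace X] {k : ℕ} {A : Fin k → Set X} (t : Fin k → ℝ)
    (hA : ∀ i, MeasurableSet (A i)) :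
    Measurable (fun ν : Config X => ∑ i, t i * (count (A i) ν).toReal) :=
  Finset.measurable_sum _ fun i _ => ((measurable_count (hA i)).ennreal_toReal).const_mul _

theorem PoissonCF.isPoissonLaw {X : Type*} [MeasurableSpace X] {μ : Measure X}
    {P : Measure (Config X)} (h : PoissonCF μ P) : IsPoissonLaw μ P := by
  have := h.isProbabilityMeasure
  have hfin : ∀ A : Set X, MeasurableSet A → μ A < ∞ →
      (fun ν => ENNReal.ofReal (count A ν).toReal) =ᵐ[P] count A := by
    intro A hA hμ
    have h1 : ∀ᵐ ν ∂P, count A ν < ∞ :=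
      ae_lt_top (measurable_count hA) (by rw [h.mean A hA]; exact hμ.ne)
    filter_upwards [h1] with ν hν using ENNReal.ofReal_toReal hν.ne
  have hcf1 : ∀ A : Set X, MeasurableSet A → μ A < ∞ → ∀ t : ℝ,
      charFun (P.map fun ν => (count A ν).toReal) t =
        Complex.exp ((μ.real A : ℂ) * (Complex.exp (t * Complex.I) - 1)) := by
    intro A hA hμ t
    have := h.cf 1 (fun _ => A) (fun _ => t) (fun _ => hA)
      (fun i j hij => absurd (Subsingleton.elim i j) hij) (fun _ => hμ)
    simp only [Finset.univ_unique, Finset.sum_singleton] at this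
    rw [← this, charFun_apply_real, charFun_apply_real,
      integral_map (measurable_count hA).ennreal_toReal.aemeasurable (by fun_prop),
      integral_map ((measurable_count hA).ennreal_toReal.const_mul _).aemeasurable (by fun_prop)]
    simp
  refine ⟨this, fun A hA hμ => ?_, fun k A hA hd hμ => ?_⟩
  · have hreal : P.map (fun ν => (count A ν).toReal) =
        (poissonMeasure (μ A).toNNReal).map (Nat.cast : ℕ → ℝ) := by
      have : IsProbabilityMeasure (P.map fun ν => (count A ν).toReal) :=
        Measure.isProbabilityMeasure_map (measurable_count hA).ennreal_toReal.aemeasurable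
      apply Measure.ext_of_charFun
      ext t
      rw [hcf1 A hA hμ, charFun_map_cast_poissonMeasure]
      rfl
    rw [← Measure.map_congr (hfin A hA hμ)]
    have := congrArg (Measure.map ENNReal.ofReal) hreal
    rw [Measure.map_map ENNReal.measurable_ofReal (measurable_count hA).ennreal_toReal,
      Measure.map_map ENNReal.measurable_ofReal .of_discrete] at this
    refine this.trans ?_
    congr 1
    ext n
    simp
  · have hreal : iIndepFun (fun i ν => (count (A i) ν).toReal) P := by
      rw [iIndepFun_iff_charFun_pi
        fun i => (measurable_count (hA i)).ennreal_toReal.aemeasurable]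
      intro t
      have h2 := h.cf k A (fun i => t i) hA hd (fun i => (hμ i))
      rw [Finset.prod_congr rfl fun i _ => hcf1 (A i) (hA i) (hμ i) (t i), ← Complex.exp_sum,
        ← h2, charFun_apply_real, charFun_apply,
        integral_map (measurable_lin (fun i => t i) hA).aemeasurable (by fun_prop),
        integral_map ?_ (by fun_prop)]
      · simp [PiLp.inner_apply, mul_comm]
      · refine Measurable.aemeasurable ?_
        have := fun i => (measurable_count (hA i)).ennreal_toReal
        fun_prop
    exact (hreal.comp (fun _ => ENNReal.ofReal) fun _ => ENNReal.measurable_ofReal).congr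
      fun i => hfin (A i) (hA i) (hμ i)

theorem lintegral_natCast_poissonMeasure (r : ℝ≥0) :
    ∫⁻ n, (n : ℝ≥0∞) ∂poissonMeasure r = r := by
  rw [poissonMeasure, lintegral_sum_measure]
  simp only [lintegral_smul_measure, lintegral_dirac, smul_eq_mul]
  rw [tsum_eq_zero_add' ENNReal.summable]
  have hs : HasSum (fun n : ℕ => Real.exp (-r) * (r : ℝ) ^ n / (n.factorial)) 1 :=
    hasSum_one_poissonMeasure r
  have : ∀ n : ℕ, ENNReal.ofReal (Real.exp (-r) * (r : ℝ) ^ (n + 1) / ((n + 1).factorial)) *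
      ((n + 1 : ℕ) : ℝ≥0∞) = r * ENNReal.ofReal (Real.exp (-r) * (r : ℝ) ^ n / (n.factorial)) := by
    intro n
    rw [← ENNReal.ofReal_natCast (n + 1), ← ENNReal.ofReal_coe_nnreal (p := r),
      ← ENNReal.ofReal_mul (by positivity), ← ENNReal.ofReal_mul (by positivity)]
    congr 1
    rw [Nat.factorial_succ]
    push_cast
    field_simp
    ring
  simp only [this]
  rw [ENNReal.tsum_mul_left, ← ENNReal.ofReal_tsum_of_nonneg (fun n => by positivity) hs.summable,
    hs.tsum_eq]
  simp

theorem exists_poissonCF_of_isFiniteMeasure {X : Type*} [MeasurableSpace X] (μ : Measure X)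
    [IsFiniteMeasure μ] : ∃ P, PoissonCF μ P := by
  rcases eq_or_ne μ 0 with rfl | h0
  · let ν₀ : Config X := ⟨0, Empty, inferInstance, Empty.elim, by simp⟩
    refine ⟨Measure.dirac ν₀, inferInstance, fun A hA => ?_, fun k A t hA hd hμ => ?_⟩
    · rw [lintegral_dirac' _ (measurable_count hA)]
      simp [count, ν₀]
    · rw [Measure.map_dirac' (measurable_lin t hA)]
      simp [charFun_dirac, count, ν₀]
  have : NeZero μ := ⟨h0⟩
  let r : ℝ≥0 := (μ Set.univ).toNNReal
  have hr : (r : ℝ≥0∞) = μ Set.univ := ENNReal.coe_toNNReal (measure_ne_top _ _)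
  let ρ : Measure X := (μ Set.univ)⁻¹ • μ
  have hρ : IsProbabilityMeasure ρ := isProbabilityMeasureSMul
  have hrρ : ∀ A, (r : ℝ≥0∞) * ρ A = μ A := by
    intro A
    rw [hr, Measure.smul_apply, smul_eq_mul, ← mul_assoc,
      ENNReal.mul_inv_cancel (by simpa using h0) (measure_ne_top _ _), one_mul]
  let Q : Measure (ℕ × (ℕ → X)) := (poissonMeasure r).prod (Measure.infinitePi fun _ => ρ)
  let Φ : ℕ × (ℕ → X) → Config X := fun p =>
    ⟨Measure.sum fun j : Fin p.1 => Measure.dirac (p.2 j), Fin p.1, inferInstance, _, rfl⟩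
  have hcount : ∀ A, MeasurableSet A → ∀ p, count A (Φ p) =
      ∑ j ∈ Finset.range p.1, A.indicator 1 (p.2 j) := by
    intro A hA p
    simp only [count, Φ, Measure.sum_apply _ hA, Measure.dirac_apply' _ hA, tsum_fintype]
    rw [Finset.sum_range]
  have hΦ : Measurable Φ := by
    refine Measurable.subtype_mk (Measure.measurable_of_measurable_coe _ fun A hA => ?_)
    have : (fun p : ℕ × (ℕ → X) => (Φ p).1 A) =
      fun p => ∑ j ∈ Finset.range p.1, A.indicator 1 (p.2 j) := funext (hcount A hA)
    change Measurable (fun p : ℕ × (ℕ → X) => (Φ p).1 A)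
    rw [this]
    have hj : ∀ j : ℕ, Measurable fun x : ℕ → X => A.indicator (1 : X → ℝ≥0∞) (x j) :=
      fun j => (measurable_one.indicator hA).comp (measurable_pi_apply j)
    exact measurable_from_prod_countable_right fun n =>
      Finset.measurable_sum (Finset.range n) fun j _ => hj j
  refine ⟨Q.map Φ, Measure.isProbabilityMeasure_map hΦ.aemeasurable, fun A hA => ?_,
    fun k A t hA hd hμ => ?_⟩
  · rw [lintegral_map (measurable_count hA) hΦ,
      lintegral_prod (fun p => count A (Φ p)) ((measurable_count hA).comp hΦ).aemeasurable]
    have : ∀ n : ℕ, ∫⁻ x, count A (Φ (n, x)) ∂(Measure.infinitePi fun _ : ℕ => ρ) = n * ρ A := by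
      intro n
      have h0 : ∀ j : ℕ, Measurable fun x : ℕ → X => A.indicator (1 : X → ℝ≥0∞) (x j) :=
        fun j => (measurable_one.indicator hA).comp (measurable_pi_apply j)
      have h1 : ∀ j : ℕ, ∫⁻ x : ℕ → X, A.indicator (1 : X → ℝ≥0∞) (x j)
          ∂(Measure.infinitePi fun _ => ρ) = ρ A := fun j =>
        ((measurePreserving_eval_infinitePi (fun _ : ℕ => ρ) j).lintegral_comp
          (f := A.indicator (1 : X → ℝ≥0∞)) (measurable_one.indicator hA)).trans
          (lintegral_indicator_one hA)
      simp only [hcount A hA]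
      rw [lintegral_finsetSum _ fun j _ => h0 j]
      simp [h1]
    simp only [this]
    rw [lintegral_mul_const _ .of_discrete, lintegral_natCast_poissonMeasure, hrρ]
  · let f : X → ℝ := fun x => ∑ i, t i * (A i).indicator 1 x
    have hf : Measurable f := Finset.measurable_sum _ fun i _ =>
      (measurable_one.indicator (hA i)).const_mul _
    have hlin : ∀ p, ∑ i, t i * (count (A i) (Φ p)).toReal = ∑ j ∈ Finset.range p.1, f (p.2 j) := by
      intro p
      simp only [f]
      rw [Finset.sum_comm]
      refine Finset.sum_congr rfl fun i _ => ?_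
      rw [hcount _ (hA i), ENNReal.toReal_sum, Finset.mul_sum]
      · refine Finset.sum_congr rfl fun j _ => ?_
        by_cases hx : p.2 j ∈ A i <;> simp [hx]
      · intro j _
        by_cases hx : p.2 j ∈ A i <;> simp [hx]
    let c : ℂ := ∫ x, Complex.exp (f x * Complex.I) ∂ρ
    have hfib : ∀ n : ℕ, ∫ x, Complex.exp ((∑ j ∈ Finset.range n, f (x j) : ℝ) * Complex.I)
        ∂(Measure.infinitePi fun _ : ℕ => ρ) = c ^ n := by
      intro n
      have hind : iIndepFun (fun (i : ℕ) (x : ℕ → X) => f (x i)) (Measure.infinitePi fun _ => ρ) :=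
        iIndepFun_infinitePi (P := fun _ : ℕ => ρ) (X := fun _ => f) fun _ => hf
      have hm : ∀ j : ℕ, Measurable fun x : ℕ → X => f (x j) :=
        fun j => hf.comp (measurable_pi_apply j)
      have h1 := congrFun ((hind.restrict (Finset.range n)).charFun_map_fun_finsetSum_eq_prod
        (X := fun (i : ℕ) (x : ℕ → X) => f (x i)) (fun i _ => (hm i).aemeasurable)) 1
      rw [charFun_apply_real,
        integral_map (Finset.measurable_sum _ fun j _ => hm j).aemeasurable (by fun_prop),
        Finset.prod_apply] at h1
      simp only [Complex.ofReal_one, one_mul] at h1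
      rw [h1, Finset.prod_eq_pow_card (b := c), Finset.card_range]
      intro j _
      rw [charFun_apply_real, integral_map (hm j).aemeasurable (by fun_prop)]
      simp only [Complex.ofReal_one, one_mul]
      have h2 := (measurePreserving_eval_infinitePi (fun _ : ℕ => ρ) j).map_eq
      have h3 : Measurable fun x => Complex.exp (f x * Complex.I) := by fun_prop
      have h4 := integral_map (μ := Measure.infinitePi fun _ : ℕ => ρ)
        (measurable_pi_apply j).aemeasurable
        (h3.aestronglyMeasurable (μ := (Measure.infinitePi fun _ : ℕ => ρ).map (Function.eval j)))
      rw [h2] at h4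
      exact h4.symm
    have hc : (r : ℂ) * (c - 1) =
        ∑ i, (μ.real (A i) : ℂ) * (Complex.exp (t i * Complex.I) - 1) := by
      have hpt : ∀ x, Complex.exp (f x * Complex.I) =
          1 + ∑ i, (A i).indicator (fun _ => Complex.exp (t i * Complex.I) - 1) x := by
        intro x
        by_cases hx : ∃ i, x ∈ A i
        · obtain ⟨i, hi⟩ := hx
          have hne : ∀ j, j ≠ i → x ∉ A j := fun j hj hxj =>
            Set.disjoint_left.1 (hd hj) hxj hi
          simp only [f]
          rw [Finset.sum_eq_single i (fun j _ hj => by simp [hne j hj]) (by simp),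
            Finset.sum_eq_single i (fun j _ hj => by simp [hne j hj]) (by simp)]
          simp [hi]
        · push Not at hx
          simp [f, hx]
      have hint : ∀ i, Integrable
          ((A i).indicator (fun _ => Complex.exp (t i * Complex.I) - 1)) ρ :=
        fun i => (integrable_const _).indicator (hA i)
      have hreal : ∀ i, (μ.real (A i) : ℂ) = r * (ρ.real (A i) : ℂ) := by
        intro i
        simp only [Measure.real, ← hrρ (A i), ENNReal.toReal_mul]
        simp
      change (r : ℂ) * ((∫ x, Complex.exp (f x * Complex.I) ∂ρ) - 1) = _
      simp only [hpt]
      rw [integral_add (integrable_const _) (integrable_finsetSum _ fun i _ => hint i),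
        integral_finsetSum _ fun i _ => hint i]
      simp only [integral_indicator (hA _), integral_const, measureReal_restrict_apply_univ,
        hreal]
      simp [Finset.mul_sum, mul_assoc]
    have hmeas : Measurable fun p : ℕ × (ℕ → X) => ∑ j ∈ Finset.range p.1, f (p.2 j) := by
      simp only [← hlin]
      exact (measurable_lin t hA).comp hΦ
    rw [charFun_apply_real, integral_map (measurable_lin t hA).aemeasurable (by fun_prop),
      integral_map hΦ.aemeasurable
        (by have := measurable_lin t hA
            exact (by fun_prop : Measurable _).aestronglyMeasurable)]
    simp only [Complex.ofReal_one, one_mul, hlin]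
    rw [integral_prod]
    · simp only [hfib]
      rw [integral_poissonMeasure, ← hc]
      have h3 := (NormedSpace.expSeries_div_hasSum_exp ((r : ℂ) * c)).mul_left
        (Complex.exp (-(r : ℂ)))
      rw [← Complex.exp_eq_exp_ℂ, ← Complex.exp_add] at h3
      rw [show (r : ℂ) * (c - 1) = -(r : ℂ) + r * c by ring, ← h3.tsum_eq]
      refine tsum_congr fun n => ?_
      simp only [Complex.real_smul]
      push_cast
      ring
    · refine Integrable.of_bound (C := 1)
        (by fun_prop : Measurable _).aestronglyMeasurable (ae_of_all _ fun p => ?_)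
      rw [Complex.norm_exp_ofReal_mul_I]

/-- Poisson measures exist. -/
theorem exists_isPoissonLaw {X : Type*} [MeasurableSpace X] (μ : Measure X) [SFinite μ] :
    ∃ P, IsPoissonLaw μ P := by
  have hsum : Measure.sum (sfiniteSeq μ) = μ := sum_sfiniteSeq μ
  choose P hP using fun m => exists_poissonCF_of_isFiniteMeasure (sfiniteSeq μ m)
  have hprob := fun m => (hP m).isProbabilityMeasure
  let Φ : (ℕ → Config X) → Config X := fun ω =>
    ⟨Measure.sum fun m => (ω m).1, isCounting_sum fun m => (ω m).2⟩
  have hcount : ∀ A, MeasurableSet A → ∀ ω, count A (Φ ω) = ∑' m, count A (ω m) :=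
    fun A hA ω => Measure.sum_apply _ hA
  have hmc : ∀ A, MeasurableSet A → ∀ m : ℕ, Measurable fun ω : ℕ → Config X => count A (ω m) :=
    fun A hA m => (measurable_count hA).comp (measurable_pi_apply m)
  have hΦ : Measurable Φ := by
    refine Measurable.subtype_mk (Measure.measurable_of_measurable_coe _ fun A hA => ?_)
    change Measurable fun ω => count A (Φ ω)
    simp only [hcount A hA]
    exact Measurable.tsum (hmc A hA)
  have hev := measurePreserving_eval_infinitePi P
  have hmean : ∀ A, MeasurableSet A →
      ∫⁻ ω, ∑' m, count A (ω m) ∂(Measure.infinitePi P) = μ A := by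
    intro A hA
    rw [lintegral_tsum fun m => (hmc A hA m).aemeasurable]
    have h1 : μ A = ∑' m, sfiniteSeq μ m A :=
      (congrArg (fun m : Measure X => m A) hsum.symm).trans (Measure.sum_apply _ hA)
    rw [h1]
    refine tsum_congr fun m => ?_
    exact ((hev m).lintegral_comp (measurable_count hA)).trans ((hP m).mean A hA)
  refine ⟨(Measure.infinitePi P).map Φ, PoissonCF.isPoissonLaw ⟨?_, fun A hA => ?_,
    fun k A t hA hd hμ => ?_⟩⟩
  · exact Measure.isProbabilityMeasure_map hΦ.aemeasurable
  · rw [lintegral_map (measurable_count hA) hΦ]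
    simp only [hcount A hA, hmean A hA]
  · let Z : Config X → ℝ := fun ν => ∑ i, t i * (count (A i) ν).toReal
    have hZ : Measurable Z := measurable_lin t hA
    have hZm : ∀ m : ℕ, Measurable fun ω : ℕ → Config X => Z (ω m) :=
      fun m => hZ.comp (measurable_pi_apply m)
    have hle : ∀ m, sfiniteSeq μ m ≤ μ := fun m =>
      (Measure.le_sum (sfiniteSeq μ) m).trans hsum.le
    let e : ℕ → ℂ := fun m =>
      ∑ i, ((sfiniteSeq μ m).real (A i) : ℂ) * (Complex.exp (t i * Complex.I) - 1)
    have hpart : ∀ M : ℕ, ∫ ω, Complex.exp ((∑ m ∈ Finset.range M, Z (ω m) : ℝ) * Complex.I)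
        ∂(Measure.infinitePi P) = Complex.exp (∑ m ∈ Finset.range M, e m) := by
      intro M
      have hind : iIndepFun (fun (m : ℕ) (ω : ℕ → Config X) => Z (ω m)) (Measure.infinitePi P) :=
        iIndepFun_infinitePi (P := P) (X := fun _ => Z) fun _ => hZ
      have h1 := congrFun ((hind.restrict (Finset.range M)).charFun_map_fun_finsetSum_eq_prod
        (X := fun (m : ℕ) (ω : ℕ → Config X) => Z (ω m)) (fun i _ => (hZm i).aemeasurable)) 1
      rw [charFun_apply_real,
        integral_map (Finset.measurable_sum _ fun j _ => hZm j).aemeasurable (by fun_prop),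
        Finset.prod_apply] at h1
      simp only [Complex.ofReal_one, one_mul] at h1
      rw [h1, Complex.exp_sum]
      refine Finset.prod_congr rfl fun m _ => ?_
      have h2 := (hP m).cf k A t hA hd fun i => (hle m (A i)).trans_lt (hμ i)
      refine Eq.trans ?_ h2
      congr 1
      rw [← (hev m).map_eq, Measure.map_map hZ (measurable_pi_apply m)]
      rfl
    have hfin : ∀ᵐ ω ∂(Measure.infinitePi P), ∀ i, ∑' m, count (A i) (ω m) ≠ ∞ := by
      rw [ae_all_iff]
      intro i
      have := ae_lt_top (Measurable.tsum (hmc (A i) (hA i)))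
        (by rw [hmean (A i) (hA i)]; exact (hμ i).ne)
      filter_upwards [this] with ω hω using hω.ne
    have hlim : ∀ᵐ ω ∂(Measure.infinitePi P),
        HasSum (fun m => Z (ω m)) (Z (Φ ω)) := by
      filter_upwards [hfin] with ω hω
      refine hasSum_sum fun i _ => HasSum.mul_left _ ?_
      rw [hcount _ (hA i), ENNReal.tsum_toReal_eq (fun m => ENNReal.ne_top_of_tsum_ne_top (hω i) m)]
      exact (ENNReal.summable_toReal (hω i)).hasSum
    have hL : Filter.Tendsto (fun M : ℕ => Complex.exp (∑ m ∈ Finset.range M, e m)) Filter.atTop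
        (nhds (Complex.exp
          (∑ i, (μ.real (A i) : ℂ) * (Complex.exp (t i * Complex.I) - 1)))) := by
      refine (Complex.continuous_exp.tendsto _).comp (HasSum.tendsto_sum_nat ?_)
      refine hasSum_sum fun i _ => HasSum.mul_right _ ?_
      rw [Complex.hasSum_ofReal]
      have h5 : μ (A i) = ∑' m, sfiniteSeq μ m (A i) :=
        (congrArg (fun m : Measure X => m (A i)) hsum.symm).trans (Measure.sum_apply _ (hA i))
      have h6 : ∑' m, sfiniteSeq μ m (A i) ≠ ∞ := h5 ▸ (hμ i).ne
      rw [Measure.real, h5,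
        ENNReal.tsum_toReal_eq (fun m => ENNReal.ne_top_of_tsum_ne_top h6 m)]
      exact (ENNReal.summable_toReal h6).hasSum
    have hR : Filter.Tendsto (fun M : ℕ =>
        ∫ ω, Complex.exp ((∑ m ∈ Finset.range M, Z (ω m) : ℝ) * Complex.I)
          ∂(Measure.infinitePi P)) Filter.atTop
        (nhds (∫ ω, Complex.exp ((Z (Φ ω) : ℝ) * Complex.I) ∂(Measure.infinitePi P))) := by
      refine tendsto_integral_of_dominated_convergence (fun _ => 1) (fun M => ?_)
        (integrable_const _) (fun M => ae_of_all _ fun ω => ?_) ?_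
      · have : Measurable fun ω : ℕ → Config X => ∑ m ∈ Finset.range M, Z (ω m) :=
          Finset.measurable_sum _ fun j _ => hZm j
        exact (by fun_prop : Measurable _).aestronglyMeasurable
      · rw [Complex.norm_exp_ofReal_mul_I]
      · filter_upwards [hlim] with ω hω
        have hcont : Continuous fun z : ℝ => Complex.exp (z * Complex.I) := by fun_prop
        exact (hcont.tendsto _).comp hω.tendsto_sum_nat
    rw [charFun_apply_real, integral_map hZ.aemeasurable (by fun_prop),
      integral_map hΦ.aemeasurable (by fun_prop : Measurable _).aestronglyMeasurable]
    simp only [Complex.ofReal_one, one_mul]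
    simp only [hpart] at hR
    exact tendsto_nhds_unique hR hL

/-- The law `μ*` on `X*` of the Poisson measure with intensity `μ`. (It is the only measure with the
property `IsPoissonLaw μ`.) -/
noncomputable def poissonLaw {X : Type*} [MeasurableSpace X] (μ : Measure X) [SigmaFinite μ] :
    Measure (Config X) :=
  (exists_isPoissonLaw μ).choose

theorem isPoissonLaw_poissonLaw {X : Type*} [MeasurableSpace X] (μ : Measure X) [SigmaFinite μ] :
    IsPoissonLaw μ (poissonLaw μ) :=
  (exists_isPoissonLaw μ).choose_spec

instance {X : Type*} [MeasurableSpace X] (μ : Measure X) [SigmaFinite μ] :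
    IsProbabilityMeasure (poissonLaw μ) :=
  (isPoissonLaw_poissonLaw μ).isProbabilityMeasure

/-- The transformation `T_* : ν ↦ ν ∘ T⁻¹` of `X*`. -/
noncomputable def suspend {X : Type*} [MeasurableSpace X] (T : X ≃ᵐ X) (ν : Config X) : Config X :=
  ⟨ν.1.map T, isCounting_map T.measurable ν.2⟩

/-- The superposition map `(ν₁, ν₂) ↦ ν₁ + ν₂`. -/
noncomputable def superpose {X : Type*} [MeasurableSpace X] (p : Config X × Config X) : Config X :=
  ⟨p.1.1 + p.2.1, isCounting_add p.1.2 p.2.2⟩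

/-- The symmetric σ-algebra on `X* × X*`: the sets of the product σ-algebra that are invariant
under the exchange of the coordinates; equivalently, the σ-algebra generated by the measurable
symmetric functions. -/
@[reducible] def symmAlgebra (X : Type*) [MeasurableSpace X] : MeasurableSpace (Config X × Config X) :=
  MeasurableSpace.invariants (Prod.swap : Config X × Config X → Config X × Config X)

/-- The restriction of `μ* ⊗ μ*` to the symmetric σ-algebra. -/
noncomputable def symmLaw {X : Type*} [MeasurableSpace X] (μ : Measure X) [SigmaFinite μ] :
    @Measure (Config X × Config X) (symmAlgebra X) :=
  ((poissonLaw μ).prod (poissonLaw μ)).trim (MeasurableSpace.invariants_le _)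

/-- A factor of the system `(Y, 𝒜, P, S)`: a sub-σ-algebra `C` of `𝒜` with `S⁻¹ C = C`. -/
def IsFactor {Y : Type*} (𝒜 : MeasurableSpace Y) (S : Y → Y) (C : MeasurableSpace Y) : Prop :=
  C ≤ 𝒜 ∧ MeasurableSpace.comap S C = C

/-- The sub-σ-algebra `C` is the whole σ-algebra `𝒜` modulo null sets. -/
def IsFull {Y : Type*} (C 𝒜 : MeasurableSpace Y) (P : @Measure Y 𝒜) : Prop :=
  ∀ A : Set Y, MeasurableSet[𝒜] A → ∃ B : Set Y, MeasurableSet[C] B ∧ A =ᵐ[P] B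

/-- The sub-σ-algebra `C` of `𝒜` is `{Y, ∅}` modulo null sets. -/
def IsTrivial {Y : Type*} (C 𝒜 : MeasurableSpace Y) (P : @Measure Y 𝒜) : Prop :=
  ∀ B : Set Y, MeasurableSet[C] B → P B = 0 ∨ P Bᶜ = 0

/-- The system `(Y, 𝒜, P, S)` is prime: modulo null sets, `𝒜` and `{Y, ∅}` are its only
factors. -/
def IsPrime {Y : Type*} (𝒜 : MeasurableSpace Y) (P : @Measure Y 𝒜) (S : Y → Y) : Prop :=
  ∀ C : MeasurableSpace Y, IsFactor 𝒜 S C → IsFull C 𝒜 P ∨ IsTrivial C 𝒜 P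

/-- `φ` is a factor map from the system `(Y, 𝒜, P, S)` onto the system `(Z, ℬ, Q, R)`. -/
def IsFactorMap {Y Z : Type*} (𝒜 : MeasurableSpace Y) (P : @Measure Y 𝒜) (S : Y → Y)
    (ℬ : MeasurableSpace Z) (Q : @Measure Z ℬ) (R : Z → Z) (φ : Y → Z) : Prop :=
  MeasurePreserving φ P Q ∧ φ ∘ S = R ∘ φ

/-- The transformation `T_* × T_*` of `X* × X*` (and `T_* ⊙ T_*`, when `X* × X*` carries the
symmetric σ-algebra). -/
noncomputable def suspendProd {X : Type*} [MeasurableSpace X] (T : X ≃ᵐ X) :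
    Config X × Config X → Config X × Config X :=
  Prod.map (suspend T) (suspend T)

/-- The sub-σ-algebra of `X* × X*` generated by the superposition map. -/
@[reducible] noncomputable def superposeAlgebra (X : Type*) [MeasurableSpace X] :
    MeasurableSpace (Config X × Config X) :=
  MeasurableSpace.comap superpose (inferInstance : MeasurableSpace (Config X))

end PoissonSuspension

open PoissonSuspension

namespace PoissonSuspension

variable {X : Type*} [MeasurableSpace X]

/-! The sum of two independent Poisson measures is Poisson and the intensities add, so superposition
carries `μ* ⊗ μ*` to `(2μ)*`. As `poissonLaw` is merely some chosen measure with the Poisson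
property, this rests on uniqueness (`PoissonCF.unique`): characteristic functions fix the joint law
of the counts in finitely many sets of finite measure, and these laws fix the measure on `X*`. Both
steps meet in `map_superpose_poissonLaw`.

The factor is non-trivial because "no point in `A`" has probability `exp (-2 μ A)`, strictly between
0 and 1 when `0 < μ A < ∞`.

It is strict because `ν₁ + ν₂` does not tell which point came from which summand
(`not_isFull_superposeAlgebra`). Split each `νᵢ` into independent parts with intensities `μ`
restricted to `Cᶜ` and to `C`, and exchange the two `C`-parts. The law and the sum are unchanged, so
every event of the factor is invariant. The symmetric event "one of the two configurations charges
both `A` and `C`" is not, even modulo null sets. -/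

/-! ### From the Poisson property to means and characteristic functions. -/

theorem IsPoissonLaw.charFun_count {μ : Measure X} {P : Measure (Config X)} (h : IsPoissonLaw μ P)
    {A : Set X} (hA : MeasurableSet A) (hμ : μ A < ∞) (t : ℝ) :
    charFun (P.map fun ν => (count A ν).toReal) t =
      Complex.exp ((μ.real A : ℂ) * (Complex.exp (t * Complex.I) - 1)) := by
  have h1 := congrArg (Measure.map ENNReal.toReal) (h.law A hA hμ)
  rw [Measure.map_map ENNReal.measurable_toReal (measurable_count hA),
    Measure.map_map ENNReal.measurable_toReal .of_discrete] at h1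
  have h2 : (ENNReal.toReal ∘ fun n : ℕ => (n : ℝ≥0∞)) = (Nat.cast : ℕ → ℝ) := by
    ext n; simp
  rw [h2] at h1
  change charFun (P.map (ENNReal.toReal ∘ count A)) t = _
  rw [h1, charFun_map_cast_poissonMeasure]
  rfl

/-- The pieces depend on `μ` alone, yet the sum formula holds for every `ν`: it serves both for the
intensity and for each configuration. -/
theorem exists_finite_partition (μ : Measure X) [SigmaFinite μ] {A : Set X}
    (hA : MeasurableSet A) :
    ∃ S : ℕ → Set X, (∀ n, MeasurableSet (S n)) ∧ (∀ n, μ (S n) < ∞) ∧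
      ∀ ν : Measure X, ν A = ∑' n, ν (S n) := by
  let S : ℕ → Set X := fun n => A ∩ disjointed (spanningSets μ) n
  have hS : ∀ n, MeasurableSet (S n) := fun n =>
    hA.inter (MeasurableSet.disjointed (measurableSet_spanningSets μ) n)
  have hSd : Pairwise (Function.onFun Disjoint S) := fun i j hij =>
    (disjoint_disjointed (spanningSets μ) hij).mono Set.inter_subset_right Set.inter_subset_right
  have hSU : ⋃ n, S n = A := by
    rw [← Set.inter_iUnion, iUnion_disjointed, iUnion_spanningSets, Set.inter_univ]
  refine ⟨S, hS, fun n => ?_, fun ν => ?_⟩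
  · exact (measure_mono (Set.inter_subset_right.trans (disjointed_subset _ n))).trans_lt
      (measure_spanningSets_lt_top μ n)
  · rw [← measure_iUnion hSd hS, hSU]

/-- The law of `count A` is prescribed only for `μ A < ∞`; sets of infinite measure are reached by
summing over pieces of finite measure. -/
theorem IsPoissonLaw.lintegral_count {μ : Measure X} [SigmaFinite μ] {P : Measure (Config X)}
    (h : IsPoissonLaw μ P) {A : Set X} (hA : MeasurableSet A) : ∫⁻ ν, count A ν ∂P = μ A := by
  have hfin : ∀ B : Set X, MeasurableSet B → μ B < ∞ → ∫⁻ ν, count B ν ∂P = μ B := by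
    intro B hB hμ
    have h1 := lintegral_map (μ := P) (f := fun x : ℝ≥0∞ => x) measurable_id (measurable_count hB)
    rw [← h1, h.law B hB hμ, lintegral_map (f := fun x : ℝ≥0∞ => x) measurable_id .of_discrete,
      lintegral_natCast_poissonMeasure, ENNReal.coe_toNNReal hμ.ne]
  obtain ⟨S, hS, hSf, hSA⟩ := exists_finite_partition μ hA
  have hc : ∀ ν : Config X, count A ν = ∑' n, count (S n) ν := fun ν => hSA ν.1
  simp only [hc]
  rw [lintegral_tsum fun n => (measurable_count (hS n)).aemeasurable]
  simp only [fun n => hfin _ (hS n) (hSf n), hSA μ]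

theorem IsPoissonLaw.poissonCF {μ : Measure X} [SigmaFinite μ] {P : Measure (Config X)}
    (h : IsPoissonLaw μ P) : PoissonCF μ P := by
  have := h.isProbabilityMeasure
  refine ⟨this, fun A hA => h.lintegral_count hA, fun k A t hA hd hμ => ?_⟩
  have hm : ∀ i, Measurable fun ν : Config X => t i * (count (A i) ν).toReal := fun i =>
    (measurable_count (hA i)).ennreal_toReal.const_mul _
  have hind : iIndepFun (fun i ν => t i * (count (A i) ν).toReal) P :=
    (h.indep k A hA hd hμ).comp (fun i x => t i * x.toReal) fun i =>
      ENNReal.measurable_toReal.const_mul _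
  rw [hind.charFun_map_fun_sum_eq_prod fun i => (hm i).aemeasurable, Finset.prod_apply,
    Complex.exp_sum]
  refine Finset.prod_congr rfl fun i _ => ?_
  rw [← h.charFun_count (hA i) (hμ i), charFun_apply_real, charFun_apply_real,
    integral_map (hm i).aemeasurable (by fun_prop),
    integral_map (measurable_count (hA i)).ennreal_toReal.aemeasurable (by fun_prop)]
  simp

theorem PoissonCF.ae_count_ne_top {μ : Measure X} {P : Measure (Config X)} (h : PoissonCF μ P)
    {A : Set X} (hA : MeasurableSet A) (hμ : μ A ≠ ∞) : ∀ᵐ ν ∂P, count A ν ≠ ∞ := by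
  filter_upwards [ae_lt_top (measurable_count hA) (by rwa [h.mean A hA])] with ν hν using hν.ne

/-! ### Superposition of independent Poisson measures. -/

theorem measurable_superpose : Measurable (superpose (X := X)) := by
  refine Measurable.subtype_mk (Measure.measurable_of_measurable_coe _ fun A hA => ?_)
  exact ((measurable_count hA).comp measurable_fst).add ((measurable_count hA).comp measurable_snd)

theorem count_superpose (A : Set X) (p : Config X × Config X) :
    count A (superpose p) = count A p.1 + count A p.2 := rfl

/-- Independence multiplies characteristic functions, and the exponent in `PoissonCF.cf` is additive
in the intensity. -/
theorem PoissonCF.superpose {μ₁ μ₂ : Measure X} {P₁ P₂ : Measure (Config X)}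
    (h₁ : PoissonCF μ₁ P₁) (h₂ : PoissonCF μ₂ P₂) :
    PoissonCF (μ₁ + μ₂) ((P₁.prod P₂).map superpose) := by
  have := h₁.isProbabilityMeasure
  have := h₂.isProbabilityMeasure
  refine ⟨Measure.isProbabilityMeasure_map measurable_superpose.aemeasurable, fun A hA => ?_,
    fun k A t hA hd hμ => ?_⟩
  · rw [lintegral_map (measurable_count hA) measurable_superpose]
    simp only [count_superpose]
    rw [lintegral_add_left (f := fun p : Config X × Config X => count A p.1)
      ((measurable_count hA).comp measurable_fst),
      (measurePreserving_fst (μ := P₁) (ν := P₂)).lintegral_comp (measurable_count hA),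
      (measurePreserving_snd (μ := P₁) (ν := P₂)).lintegral_comp (measurable_count hA),
      h₁.mean A hA, h₂.mean A hA, Measure.add_apply]
  · have hf₁ : ∀ i, μ₁ (A i) < ∞ := fun i =>
      (Measure.le_add_right le_rfl (A i)).trans_lt (hμ i)
    have hf₂ : ∀ i, μ₂ (A i) < ∞ := fun i =>
      (Measure.le_add_left le_rfl (A i)).trans_lt (hμ i)
    let Z : Config X → ℝ := fun ν => ∑ i, t i * (count (A i) ν).toReal
    have hZ : Measurable Z := measurable_lin t hA
    have e₁ : ∀ᵐ p ∂P₁.prod P₂, ∀ i, count (A i) p.1 ≠ ∞ := ae_all_iff.2 fun i =>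
      Measure.quasiMeasurePreserving_fst.ae (h₁.ae_count_ne_top (hA i) (hf₁ i).ne)
    have e₂ : ∀ᵐ p ∂P₁.prod P₂, ∀ i, count (A i) p.2 ≠ ∞ := ae_all_iff.2 fun i =>
      Measure.quasiMeasurePreserving_snd.ae (h₂.ae_count_ne_top (hA i) (hf₂ i).ne)
    -- Only almost everywhere: `toReal` sends `∞` to `0`, so it is additive only where both counts
    -- are finite.
    have hae : (fun p => Z (PoissonSuspension.superpose p)) =ᵐ[P₁.prod P₂]
        fun p => Z p.1 + Z p.2 := by
      filter_upwards [e₁, e₂] with p hp₁ hp₂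
      simp only [Z, ← Finset.sum_add_distrib, ← mul_add]
      refine Finset.sum_congr rfl fun i _ => ?_
      rw [count_superpose, ENNReal.toReal_add (hp₁ i) (hp₂ i)]
    have hind : IndepFun (fun p : Config X × Config X => Z p.1) (fun p => Z p.2) (P₁.prod P₂) :=
      indepFun_prod hZ hZ
    have hZ₁ : Measurable fun p : Config X × Config X => Z p.1 := hZ.comp measurable_fst
    have hZ₂ : Measurable fun p : Config X × Config X => Z p.2 := hZ.comp measurable_snd
    rw [Measure.map_map hZ measurable_superpose]
    change charFun ((P₁.prod P₂).map fun p => Z (PoissonSuspension.superpose p)) 1 = _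
    rw [Measure.map_congr hae, hind.charFun_map_fun_add_eq_mul hZ₁.aemeasurable hZ₂.aemeasurable, Pi.mul_apply]
    have m₁ : (P₁.prod P₂).map (fun p => Z p.1) = P₁.map Z := by
      have := Measure.map_map (μ := P₁.prod P₂) hZ measurable_fst
      rw [measurePreserving_fst.map_eq] at this
      exact this.symm
    have m₂ : (P₁.prod P₂).map (fun p => Z p.2) = P₂.map Z := by
      have := Measure.map_map (μ := P₁.prod P₂) hZ measurable_snd
      rw [measurePreserving_snd.map_eq] at this
      exact this.symm
    rw [m₁, m₂, h₁.cf k A t hA hd hf₁, h₂.cf k A t hA hd hf₂, ← Complex.exp_add,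
      ← Finset.sum_add_distrib]
    congr 1
    refine Finset.sum_congr rfl fun i _ => ?_
    rw [measureReal_add_apply (hf₁ i).ne (hf₂ i).ne]
    push_cast
    ring

/-! ### Uniqueness of the Poisson law. -/

/-- The characteristic function at `1` of a linear combination of counts is determined by the
intensity, even when the sets overlap. -/
theorem PoissonCF.charFun_sum_eq {ι : Type*} [Fintype ι] {μ : Measure X} {P Q : Measure (Config X)}
    (hP : PoissonCF μ P) (hQ : PoissonCF μ Q) (A : ι → Set X) (t : ι → ℝ)
    (hA : ∀ i, MeasurableSet (A i)) (hμ : ∀ i, μ (A i) ≠ ∞) :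
    charFun (P.map fun ν => ∑ i, t i * (count (A i) ν).toReal) 1 =
      charFun (Q.map fun ν => ∑ i, t i * (count (A i) ν).toReal) 1 := by
  classical
  -- The linear combination of counts is `∫ f ∂ν`, where `f` is the same combination of indicators.
  -- Rewriting this integral over the level sets of `f` replaces the overlapping `A i` by disjoint
  -- sets, to which `PoissonCF.cf` applies.
  let f : SimpleFunc X ℝ :=
    { toFun := fun x => ∑ i, (A i).indicator (fun _ => t i) x
      measurableSet_fiber' := fun c => (Finset.measurable_sum Finset.univ fun i _ =>
        measurable_const.indicator (hA i)) (measurableSet_singleton c)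
      finite_range' := by
        refine (Set.finite_range fun J : Finset ι => ∑ i ∈ J, t i).subset ?_
        rintro _ ⟨x, rfl⟩
        refine ⟨Finset.univ.filter fun i => x ∈ A i, ?_⟩
        simp only [Finset.sum_filter, Set.indicator_apply] }
  have hf : ∀ x, f x = ∑ i, (A i).indicator (fun _ => t i) x := fun _ => rfl
  -- The value `0` is dropped because its level set may have infinite measure; the other level sets
  -- lie in the union of the `A i`.
  let s : Finset ℝ := {c ∈ f.range | c ≠ 0}
  let c : Fin s.card → ℝ := fun j => (s.equivFin.symm j : ℝ)
  let B : Fin s.card → Set X := fun j => f ⁻¹' {c j}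
  have hB : ∀ j, MeasurableSet (B j) := fun j => f.measurableSet_fiber _
  have hBd : Pairwise (Function.onFun Disjoint B) := by
    intro i j hij
    refine Disjoint.preimage f (Set.disjoint_singleton.2 fun h => hij ?_)
    exact s.equivFin.symm.injective (Subtype.ext h)
  have hBf : ∀ j, μ (B j) < ∞ := by
    intro j
    have hsub : B j ⊆ ⋃ i, A i := by
      intro x hx
      by_contra hxA
      simp only [Set.mem_iUnion, not_exists] at hxA
      have h0 : c j ≠ 0 := (Finset.mem_filter.1 (s.equivFin.symm j).2).2
      apply h0
      rw [← (show f x = c j from hx), hf]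
      exact Finset.sum_eq_zero fun i _ => Set.indicator_of_notMem (hxA i) _
    refine (measure_mono hsub).trans_lt ((measure_iUnion_fintype_le μ A).trans_lt ?_)
    exact ENNReal.sum_lt_top.2 fun i _ => (hμ i).lt_top
  have key : ∀ {R : Measure (Config X)}, PoissonCF μ R →
      (fun ν => ∑ i, t i * (count (A i) ν).toReal) =ᵐ[R]
        fun ν => ∑ j, c j * (count (B j) ν).toReal := by
    intro R hR
    filter_upwards [ae_all_iff.2 fun i => hR.ae_count_ne_top (hA i) (hμ i)] with ν hν
    have hi : ∀ i, Integrable ((A i).indicator fun _ => t i) ν.1 := fun i =>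
      (integrable_indicator_iff (hA i)).2 (integrableOn_const (hν i))
    have hfi : Integrable f ν.1 := by
      rw [show (f : X → ℝ) = fun x => ∑ i, (A i).indicator (fun _ => t i) x from funext hf]
      exact integrable_finsetSum _ fun i _ => hi i
    have h1 : ∫ x, f x ∂ν.1 = ∑ i, t i * (count (A i) ν).toReal := by
      simp only [hf]
      rw [integral_finsetSum _ fun i _ => hi i]
      refine Finset.sum_congr rfl fun i _ => ?_
      rw [integral_indicator_const _ (hA i), smul_eq_mul, mul_comm]
      rfl
    rw [← h1, ← f.integral_eq_integral hfi, SimpleFunc.integral_eq_sum_filter,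
      ← s.sum_coe_sort fun x => ν.1.real (f ⁻¹' {x}) • x, ← s.equivFin.symm.sum_comp]
    exact Finset.sum_congr rfl fun j _ => mul_comm _ _
  rw [Measure.map_congr (key hP), Measure.map_congr (key hQ), hP.cf _ B c hB hBd hBf,
    hQ.cf _ B c hB hBd hBf]

/-- The Cramér–Wold device: the characteristic function of the vector of counts at `t` is that of
its linear combination with coefficients `t` at `1`. -/
theorem PoissonCF.map_count_eq {ι : Type*} [Fintype ι] {μ : Measure X} {P Q : Measure (Config X)}
    (hP : PoissonCF μ P) (hQ : PoissonCF μ Q) (A : ι → Set X)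
    (hA : ∀ i, MeasurableSet (A i)) (hμ : ∀ i, μ (A i) ≠ ∞) :
    P.map (fun ν i => count (A i) ν) = Q.map (fun ν i => count (A i) ν) := by
  have := hP.isProbabilityMeasure
  have := hQ.isProbabilityMeasure
  let V : Config X → EuclideanSpace ℝ ι := fun ν => WithLp.toLp 2 fun i => (count (A i) ν).toReal
  have hV : Measurable V := by
    have := fun i => (measurable_count (hA i)).ennreal_toReal
    fun_prop
  have hVeq : P.map V = Q.map V := by
    have := Measure.isProbabilityMeasure_map (μ := P) hV.aemeasurable
    have := Measure.isProbabilityMeasure_map (μ := Q) hV.aemeasurable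
    have hcf : ∀ {R : Measure (Config X)} (t : EuclideanSpace ℝ ι), charFun (R.map V) t =
        charFun (R.map fun ν => ∑ i, t i * (count (A i) ν).toReal) 1 := by
      intro R t
      rw [charFun_apply_real, charFun_apply, integral_map hV.aemeasurable (by fun_prop),
        integral_map (Finset.measurable_sum _ fun i _ =>
          (measurable_count (hA i)).ennreal_toReal.const_mul _).aemeasurable (by fun_prop)]
      simp [V, PiLp.inner_apply]
    refine Measure.ext_of_charFun (funext fun t => ?_)
    rw [hcf, hcf, hP.charFun_sum_eq hQ A t hA hμ]
  -- The counts are almost surely finite, so `W` recovers them from their real values.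
  let W : EuclideanSpace ℝ ι → ι → ℝ≥0∞ := fun v i => ENNReal.ofReal (v i)
  have hW : Measurable W := by fun_prop
  have hWV : ∀ {R : Measure (Config X)}, PoissonCF μ R →
      (fun ν i => count (A i) ν) =ᵐ[R] W ∘ V := by
    intro R hR
    filter_upwards [ae_all_iff.2 fun i => hR.ae_count_ne_top (hA i) (hμ i)] with ν hν
    ext i
    simp [W, V, ENNReal.ofReal_toReal (hν i)]
  rw [Measure.map_congr (hWV hP), Measure.map_congr (hWV hQ), ← Measure.map_map hW hV,
    ← Measure.map_map hW hV, hVeq]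

/-- The σ-algebra of the configuration space is generated by the counts in sets of finite
measure. -/
theorem comap_count_finite (μ : Measure X) [SigmaFinite μ] :
    (inferInstance : MeasurableSpace (Config X)) =
      MeasurableSpace.comap
        (fun ν (A : {A : Set X // MeasurableSet A ∧ μ A ≠ ∞}) => count A.1 ν) inferInstance := by
  let Φ : Config X → {A : Set X // MeasurableSet A ∧ μ A ≠ ∞} → ℝ≥0∞ := fun ν A => count A.1 ν
  refine le_antisymm ?_ ?_
  · have hcount : ∀ A, MeasurableSet A →
        @Measurable _ _ (MeasurableSpace.comap Φ inferInstance) _ (count (X := X) A) := by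
      intro A hA
      -- A count in an arbitrary set is a countable sum of counts in sets of finite measure, hence
      -- measurable for the smaller σ-algebra.
      obtain ⟨S, hS, hSf, hSA⟩ := exists_finite_partition μ hA
      have hc : count (X := X) A = fun ν => ∑' n, Φ ν ⟨S n, hS n, (hSf n).ne⟩ :=
        funext fun ν => hSA ν.1
      have hG : Measurable fun u : {A : Set X // MeasurableSet A ∧ μ A ≠ ∞} → ℝ≥0∞ =>
          ∑' n, u ⟨S n, hS n, (hSf n).ne⟩ :=
        Measurable.tsum fun n => measurable_pi_apply _
      rw [hc]
      exact hG.comp (comap_measurable Φ)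
    have hval : @Measurable _ _ (MeasurableSpace.comap Φ inferInstance) _
        (Subtype.val : Config X → Measure X) :=
      @Measure.measurable_of_measurable_coe _ _ _ (MeasurableSpace.comap Φ inferInstance) _ hcount
    exact hval.comap_le
  · exact (measurable_pi_lambda _ fun A => measurable_count A.2.1).comap_le

/-- The images under the family of all finite-measure counts have equal finite-dimensional
marginals, so they agree on the product space. By `comap_count_finite` every measurable set of
configurations is pulled back from there. -/
theorem PoissonCF.unique {μ : Measure X} [SigmaFinite μ] {P Q : Measure (Config X)}
    (hP : PoissonCF μ P) (hQ : PoissonCF μ Q) : P = Q := by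
  have := hP.isProbabilityMeasure
  have := hQ.isProbabilityMeasure
  let Φ : Config X → {A : Set X // MeasurableSet A ∧ μ A ≠ ∞} → ℝ≥0∞ := fun ν A => count A.1 ν
  have hΦ : Measurable Φ := measurable_pi_lambda _ fun A => measurable_count A.2.1
  have hproj : ∀ I : Finset {A : Set X // MeasurableSet A ∧ μ A ≠ ∞},
      (P.map Φ).map I.restrict = (Q.map Φ).map I.restrict := by
    intro I
    rw [Measure.map_map (Finset.measurable_restrict I) hΦ,
      Measure.map_map (Finset.measurable_restrict I) hΦ]
    exact hP.map_count_eq hQ (fun A : I => A.1.1) (fun A => A.1.2.1) fun A => A.1.2.2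
  have hmap : P.map Φ = Q.map Φ := by
    have := Measure.isProbabilityMeasure_map (μ := Q) hΦ.aemeasurable
    have := fun I : Finset {A : Set X // MeasurableSet A ∧ μ A ≠ ∞} =>
      Measure.isProbabilityMeasure_map (μ := Q.map Φ) (Finset.measurable_restrict I).aemeasurable
    exact IsProjectiveLimit.unique (P := fun I => (Q.map Φ).map I.restrict) hproj fun _ => rfl
  ext s hs
  obtain ⟨u, hu, rfl⟩ := (comap_count_finite (X := X) μ).le s hs
  have := congrArg (fun m => m u) hmap
  simpa only [Measure.map_apply hΦ hu] using this

/-- Used for `μ + μ = 2 • μ` in the factor map, and for the splitting of `μ` over `Cᶜ` and `C` in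
the strictness proof. -/
theorem map_superpose_poissonLaw (μ₁ μ₂ : Measure X) [SigmaFinite μ₁] [SigmaFinite μ₂]
    {μ : Measure X} [SigmaFinite μ] (h : μ₁ + μ₂ = μ) :
    ((poissonLaw μ₁).prod (poissonLaw μ₂)).map superpose = poissonLaw μ := by
  subst h
  exact ((isPoissonLaw_poissonLaw μ₁).poissonCF.superpose
    (isPoissonLaw_poissonLaw μ₂).poissonCF).unique (isPoissonLaw_poissonLaw _).poissonCF

/-! ### Probabilities of empty regions. -/

theorem measurableSet_count_eq_zero {A : Set X} (hA : MeasurableSet A) :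
    MeasurableSet {ν : Config X | count A ν = 0} :=
  measurable_count hA (measurableSet_singleton 0)

theorem IsPoissonLaw.measure_count_eq_zero_ne_zero {μ : Measure X} {P : Measure (Config X)}
    (h : IsPoissonLaw μ P) {A : Set X} (hA : MeasurableSet A) (hμ : μ A < ∞) :
    P {ν | count A ν = 0} ≠ 0 := by
  have h1 := congrArg (fun m => m {0}) (h.law A hA hμ)
  simp only [Measure.map_apply (measurable_count hA) (measurableSet_singleton _)] at h1
  rw [Measure.map_apply .of_discrete (measurableSet_singleton _)] at h1
  have h2 : (fun n : ℕ => (n : ℝ≥0∞)) ⁻¹' {0} = {0} := by ext n; simp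
  rw [h2, poissonMeasure_singleton] at h1
  change P (count A ⁻¹' {0}) ≠ 0
  rw [h1]
  simp [Real.exp_pos]

theorem PoissonCF.ae_count_eq_zero_iff {μ : Measure X} {P : Measure (Config X)}
    (h : PoissonCF μ P) {A : Set X} (hA : MeasurableSet A) :
    (∀ᵐ ν ∂P, count A ν = 0) ↔ μ A = 0 := by
  rw [← h.mean A hA, lintegral_eq_zero_iff (measurable_count hA)]
  rfl

/-! ### Superposition as a factor map. -/

theorem symmLaw_apply (μ : Measure X) [SigmaFinite μ] {s : Set (Config X × Config X)}
    (hs : MeasurableSet[symmAlgebra X] s) :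
    symmLaw μ s = (poissonLaw μ).prod (poissonLaw μ) s :=
  trim_measurableSet_eq _ hs

theorem superpose_swap (p : Config X × Config X) : superpose p.swap = superpose p :=
  Subtype.ext (add_comm _ _)

theorem measurable_superpose_symmAlgebra : Measurable[symmAlgebra X] (superpose (X := X)) :=
  fun s hs => ⟨measurable_superpose hs, by
    rw [← Set.preimage_comp, show superpose ∘ Prod.swap = superpose (X := X) from
      funext superpose_swap]⟩

theorem measurable_suspend (T : X ≃ᵐ X) : Measurable (suspend T) := by
  refine Measurable.subtype_mk (Measure.measurable_of_measurable_coe _ fun A hA => ?_)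
  simp only [Measure.map_apply T.measurable hA]
  exact measurable_count (T.measurable hA)

theorem suspend_symm_suspend (T : X ≃ᵐ X) (ν : Config X) : suspend T.symm (suspend T ν) = ν :=
  Subtype.ext T.map_symm_map

/-- Invertibility of `T` gives equality instead of mere inclusion, as the definition of a factor
demands. -/
theorem comap_suspend (T : X ≃ᵐ X) :
    MeasurableSpace.comap (suspend T) inferInstance =
      (inferInstance : MeasurableSpace (Config X)) := by
  refine le_antisymm (measurable_suspend T).comap_le fun s hs => ?_
  refine ⟨suspend T.symm ⁻¹' s, measurable_suspend T.symm hs, ?_⟩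
  ext ν
  simp [suspend_symm_suspend]

theorem superpose_comp_suspendProd (T : X ≃ᵐ X) :
    superpose ∘ suspendProd T = suspend T ∘ superpose :=
  funext fun p => Subtype.ext (Measure.map_add p.1.1 p.2.1 T.measurable).symm

theorem symmLaw_preimage_superpose (μ : Measure X) [SigmaFinite μ] {s : Set (Config X)}
    (hs : MeasurableSet s) :
    symmLaw μ (superpose ⁻¹' s) = poissonLaw ((2 : ℝ≥0) • μ) s := by
  rw [symmLaw_apply μ (measurable_superpose_symmAlgebra hs),
    ← map_superpose_poissonLaw μ μ (two_smul ℝ≥0 μ).symm, Measure.map_apply measurable_superpose hs]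

theorem isFactorMap_superpose (μ : Measure X) [SigmaFinite μ] (T : X ≃ᵐ X) :
    IsFactorMap (symmAlgebra X) (symmLaw μ) (suspendProd T)
      inferInstance (poissonLaw ((2 : ℝ≥0) • μ)) (suspend T) superpose := by
  refine ⟨@MeasurePreserving.mk _ _ (symmAlgebra X) _ _ _ _ measurable_superpose_symmAlgebra ?_,
    superpose_comp_suspendProd T⟩
  refine Measure.ext fun s hs => ?_
  exact (@Measure.map_apply _ _ (symmAlgebra X) _ _ _ measurable_superpose_symmAlgebra _ hs).trans
    (symmLaw_preimage_superpose μ hs)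

theorem isFactor_superposeAlgebra (T : X ≃ᵐ X) :
    IsFactor (symmAlgebra X) (suspendProd T) (superposeAlgebra X) := by
  refine ⟨measurable_superpose_symmAlgebra.comap_le, ?_⟩
  rw [MeasurableSpace.comap_comp, superpose_comp_suspendProd, ← MeasurableSpace.comap_comp,
    comap_suspend]

/-! ### The factor is neither trivial nor full. -/

theorem not_isTrivial_superposeAlgebra (μ : Measure X) [SigmaFinite μ] {A : Set X}
    (hA : MeasurableSet A) (h0 : μ A ≠ 0) (hf : μ A < ∞) :
    ¬ IsTrivial (superposeAlgebra X) (symmAlgebra X) (symmLaw μ) := by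
  intro h
  have hs := measurableSet_count_eq_zero hA
  have hP := isPoissonLaw_poissonLaw ((2 : ℝ≥0) • μ)
  have h2 : ((2 : ℝ≥0) • μ) A = 2 * μ A := rfl
  rcases h _ ⟨_, hs, rfl⟩ with h | h
  · rw [symmLaw_preimage_superpose μ hs] at h
    exact hP.measure_count_eq_zero_ne_zero hA (by rw [h2]; finiteness) h
  · rw [← Set.preimage_compl, symmLaw_preimage_superpose μ hs.compl] at h
    have := (hP.poissonCF.ae_count_eq_zero_iff hA).1 h
    rw [h2] at this
    simp [h0] at this

/-- Applied with equal first factors and equal second factors, this makes the exchange of the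
`C`-parts an automorphism of the product law. -/
theorem measurePreserving_exchange_snd {α β γ δ : Type*} [MeasurableSpace α] [MeasurableSpace β]
    [MeasurableSpace γ] [MeasurableSpace δ] (μ : Measure α) (ν : Measure β) (ρ : Measure γ)
    (τ : Measure δ) [SFinite μ] [SFinite ν] [SFinite ρ] [SFinite τ] :
    MeasurePreserving (fun q : (α × β) × (γ × δ) => ((q.1.1, q.2.2), (q.2.1, q.1.2)))
      ((μ.prod ν).prod (ρ.prod τ)) ((μ.prod τ).prod (ρ.prod ν)) := by
  have h₁ := measurePreserving_prodAssoc μ ν (ρ.prod τ)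
  have h₂ : MeasurePreserving (fun q : β × (γ × δ) => (q.2.2, (q.2.1, q.1)))
      (ν.prod (ρ.prod τ)) (τ.prod (ρ.prod ν)) :=
    (measurePreserving_prodAssoc τ ρ ν).comp
      (((Measure.measurePreserving_swap (μ := ρ) (ν := τ)).prod (MeasurePreserving.id ν)).comp
        Measure.measurePreserving_swap)
  exact ((measurePreserving_prodAssoc μ τ (ρ.prod ν)).symm _).comp
    (((MeasurePreserving.id μ).prod h₂).comp h₁)

theorem not_isFull_superposeAlgebra (μ : Measure X) [SigmaFinite μ] {A C : Set X}
    (hA : MeasurableSet A) (hC : MeasurableSet C) (hAC : Disjoint A C)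
    (hA0 : μ A ≠ 0) (hC0 : μ C ≠ 0) (hAf : μ A < ∞) (hCf : μ C < ∞) :
    ¬ IsFull (superposeAlgebra X) (symmAlgebra X) (symmLaw μ) := by
  intro h
  let D : Set (Config X × Config X) :=
    {p | (count A p.1 ≠ 0 ∧ count C p.1 ≠ 0) ∨ (count A p.2 ≠ 0 ∧ count C p.2 ≠ 0)}
  have mA := (measurableSet_count_eq_zero hA).compl
  have mC := (measurableSet_count_eq_zero hC).compl
  have hD : MeasurableSet[symmAlgebra X] D := by
    refine ⟨?_, Set.ext fun p => or_comm⟩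
    exact ((measurable_fst mA).inter (measurable_fst mC)).union
      ((measurable_snd mA).inter (measurable_snd mC))
  obtain ⟨_, ⟨B, hB, rfl⟩, hDB⟩ := h D hD
  have hDB' : D =ᵐ[(poissonLaw μ).prod (poissonLaw μ)] superpose ⁻¹' B :=
    ae_eq_of_ae_eq_trim hDB
  let P₁ := poissonLaw (μ.restrict Cᶜ)
  let P₂ := poissonLaw (μ.restrict C)
  have h₁ := isPoissonLaw_poissonLaw (μ.restrict Cᶜ)
  have h₂ := isPoissonLaw_poissonLaw (μ.restrict C)
  have hsup : (P₁.prod P₂).map superpose = poissonLaw μ :=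
    map_superpose_poissonLaw _ _ (Measure.restrict_compl_add_restrict hC)
  let R := (P₁.prod P₂).prod (P₁.prod P₂)
  let F : (Config X × Config X) × (Config X × Config X) → Config X × Config X :=
    Prod.map superpose superpose
  let σ : (Config X × Config X) × (Config X × Config X) →
      (Config X × Config X) × (Config X × Config X) :=
    fun q => ((q.1.1, q.2.2), (q.2.1, q.1.2))
  have hs : MeasurePreserving superpose (P₁.prod P₂) (poissonLaw μ) := ⟨measurable_superpose, hsup⟩
  have hF : MeasurePreserving F R ((poissonLaw μ).prod (poissonLaw μ)) := hs.prod hs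
  have hσ : MeasurePreserving σ R R := measurePreserving_exchange_snd _ _ _ _
  have e₁ : F ⁻¹' D =ᵐ[R] F ⁻¹' (superpose ⁻¹' B) := hF.quasiMeasurePreserving.preimage_ae_eq hDB'
  have e₂ : σ ⁻¹' (F ⁻¹' D) =ᵐ[R] σ ⁻¹' (F ⁻¹' (superpose ⁻¹' B)) :=
    hσ.quasiMeasurePreserving.preimage_ae_eq e₁
  -- The total of the four parts does not depend on how they are paired.
  have hinv : σ ⁻¹' (F ⁻¹' (superpose ⁻¹' B)) = F ⁻¹' (superpose ⁻¹' B) := by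
    ext q
    have : superpose (F (σ q)) = superpose (F q) := by
      refine Subtype.ext ?_
      change (q.1.1.1 + q.2.2.1) + (q.2.1.1 + q.1.2.1) = (q.1.1.1 + q.1.2.1) + (q.2.1.1 + q.2.2.1)
      abel
    simp only [Set.mem_preimage, this]
  rw [hinv] at e₂
  have e : F ⁻¹' D =ᵐ[R] σ ⁻¹' (F ⁻¹' D) := e₁.trans e₂.symm
  -- Under `P₁` the set `C` is almost surely empty, so a null `U₁` would force `A` to be almost
  -- surely empty too, whence `μ A = 0`. The case of `U₂` under `P₂` is symmetric.
  let U₁ : Set (Config X) := {ν | count C ν = 0} ∩ {ν | count A ν = 0}ᶜ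
  let U₂ : Set (Config X) := {ν | count A ν = 0} ∩ {ν | count C ν = 0}ᶜ
  have hU₁ : P₁ U₁ ≠ 0 := by
    intro h0
    have hC' := (h₁.poissonCF.ae_count_eq_zero_iff hC).2 (by simp [Measure.restrict_apply hC])
    have hA' := (h₁.poissonCF.ae_count_eq_zero_iff hA).1 <| by
      filter_upwards [hC', measure_eq_zero_iff_ae_notMem.1 h0] with ν hν hνU
      by_contra hνA
      exact hνU ⟨hν, hνA⟩
    rw [Measure.restrict_apply hA, Set.inter_eq_left.2 hAC.subset_compl_right] at hA'
    exact hA0 hA'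
  have hU₂ : P₂ U₂ ≠ 0 := by
    intro h0
    have hA' := (h₂.poissonCF.ae_count_eq_zero_iff hA).2
      (by simp [Measure.restrict_apply hA, hAC.inter_eq])
    have hC' := (h₂.poissonCF.ae_count_eq_zero_iff hC).1 <| by
      filter_upwards [hA', measure_eq_zero_iff_ae_notMem.1 h0] with ν hν hνU
      by_contra hνC
      exact hνU ⟨hν, hνC⟩
    rw [Measure.restrict_apply hC, Set.inter_self] at hC'
    exact hC0 hC'
  have hV₁ : P₁ {ν | count A ν = 0} ≠ 0 := h₁.measure_count_eq_zero_ne_zero hA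
    ((Measure.restrict_apply_le _ _).trans_lt hAf)
  have hV₂ : P₂ {ν | count C ν = 0} ≠ 0 := h₂.measure_count_eq_zero_ne_zero hC
    ((Measure.restrict_apply_le _ _).trans_lt hCf)
  have hpos : R ((U₁ ×ˢ U₂) ×ˢ ({ν | count A ν = 0} ×ˢ {ν | count C ν = 0})) ≠ 0 := by
    simp only [R, Measure.prod_prod]
    exact mul_ne_zero (mul_ne_zero hU₁ hU₂) (mul_ne_zero hV₁ hV₂)
  -- On this product set `a + b` charges both `A` and `C`, so the pair lies in `D`. After the
  -- exchange, `a + b'` misses `C` and `a' + b` misses `A`, so the new pair lies outside `D`.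
  refine hpos (measure_mono_null ?_ (ae_iff.1 e.mem_iff))
  rintro ⟨⟨a, b⟩, a', b'⟩ ⟨⟨⟨haC, haA⟩, hbA, hbC⟩, ha'A, hb'C⟩ hiff
  have hin : (count A (superpose (a, b)) ≠ 0 ∧ count C (superpose (a, b)) ≠ 0) :=
    ⟨fun h => haA (add_eq_zero.1 h).1, fun h => hbC (add_eq_zero.1 h).2⟩
  rcases hiff.1 (Or.inl hin) with h | h
  · exact h.2 (add_eq_zero.2 ⟨haC, hb'C⟩)
  · exact h.1 (add_eq_zero.2 ⟨ha'A, hbA⟩)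

end PoissonSuspension

open PoissonSuspension
theorem proposition4p4 {X : Type*} [MeasurableSpace X] (μ : Measure X) [SigmaFinite μ]
    (hinf : μ Set.univ = ∞) (hcont : ∀ x : X, μ {x} = 0)
    (T : X ≃ᵐ X) (hT : MeasurePreserving T μ μ) :
    -- the symmetric factor of the direct product of two copies of the suspension is not prime
    ¬ IsPrime (symmAlgebra X) (symmLaw μ) (suspendProd T) ∧
    -- superposition is a factor map from it onto the suspension with intensity `2 μ`
    IsFactorMap (symmAlgebra X) (symmLaw μ) (suspendProd T)
      inferInstance (poissonLaw ((2 : ℝ≥0) • μ)) (suspend T) superpose ∧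
    -- the corresponding sub-σ-algebra is a factor, it is strict, and it is non-trivial
    IsFactor (symmAlgebra X) (suspendProd T) (superposeAlgebra X) ∧
    ¬ IsFull (superposeAlgebra X) (symmAlgebra X) (symmLaw μ) ∧
    ¬ IsTrivial (superposeAlgebra X) (symmAlgebra X) (symmLaw μ) := by
  have hex : ∀ {ρ : Measure X} [SigmaFinite ρ], ρ ≠ 0 →
      ∃ A, MeasurableSet A ∧ ρ A ≠ 0 ∧ ρ A < ∞ := by
    intro ρ _ hρ
    by_contra! hcon
    apply hρ
    rw [← Measure.measure_univ_eq_zero, ← iUnion_spanningSets ρ, measure_iUnion_null_iff]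
    intro n
    by_contra hn
    exact (hcon _ (measurableSet_spanningSets ρ n) hn).not_gt (measure_spanningSets_lt_top ρ n)
  obtain ⟨A, hA, hA0, hAf⟩ := hex (ρ := μ) fun h => by simp [h] at hinf
  -- The restriction is non-zero because `μ A < ∞` while `μ` is infinite. The set disjoint from `A`
  -- is `C ∩ Aᶜ`.
  obtain ⟨C, hC, hC0, hCf⟩ := hex (ρ := μ.restrict Aᶜ) fun h => by
    rw [Measure.restrict_eq_zero] at h
    rw [← measure_add_measure_compl hA, h, add_zero] at hinf
    exact hAf.ne hinf
  rw [Measure.restrict_apply hC] at hC0 hCf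
  have hfull := not_isFull_superposeAlgebra μ hA (hC.inter hA.compl)
    (Set.disjoint_left.2 fun x hx hx' => hx'.2 hx) hA0 hC0 hAf hCf
  have htriv := not_isTrivial_superposeAlgebra μ hA hA0 hAf
  have hfac := isFactor_superposeAlgebra T
  exact ⟨fun h => (h _ hfac).elim hfull htriv, isFactorMap_superpose μ T, hfac, hfull, htriv⟩
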